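/- A map $f\colon\mathbb T\to\mathbb C$ on the unit circle $\mathbb T\subset\mathbb C$ is $(L,\ell)$-bi-Lipschitz, where $L,\ell>0$, if $$\ell\,|a-b|\le |f(a)-f(b)|\le L\,|a-b|\qquad\text{for all } a,b\in\mathbb T.$$ Let $W\colon\mathbb C\to\mathbb C$ be the winding map $W(re^{i\theta})=re^{2i\theta}$. If $f\colon\mathbb T\to\mathbb C\setminus\{0\}$ is a homeomorphism onto its image and $f(\mathbb T)$ separates $0$ from $\infty$, a winding symmetrization of $f$ is a map $g\colon\mathbb T\to\mathbb C\setminus\{0\}$ that is a homeomorphism onto its image and satisfies $f\circ W=W\circ g$ on $\mathbb T$. An incenter of a bounded domain $\Omega$ is the center of a disk contained in $\Omega$ of the largest possible radius. **Corollary.** Let $f\colon\mathbb T\to\mathbb C$ be $(L,\ell)$-bi-Lipschitz, and let $\Omega$ be the bounded domain enclosed by the Jordan curve $f(\mathbb T)$. Then $\Omega$ has an incenter, and for every incenter $w_0$ of $\Omega$ the map $f-w_0$ has a winding symmetrization $g$, which is unique up to sign, and $g$ is $\left(\pi L,\ \dfrac{\ell^2}{2\pi L}\right)$-bi-Lipschitz.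 In particular, there is a point $w_0\in\mathbb C$ such that the winding symmetrization of $f-w_0$ is $\left(\pi L,\ \ell^2/(2\pi L)\right)$-bi-Lipschitz. -/

import Mathlib

/-- A map `f` from the unit circle (with the Euclidean distance of the plane) to the plane is
`(L, ℓ)`-bi-Lipschitz: `L` and `ℓ` are positive and `ℓ |a - b| ≤ |f a - f b| ≤ L |a - b|`. -/
def IsBiLipschitz (L l : ℝ) (f : Circle → ℂ) : Prop :=
  0 < L ∧ 0 < l ∧ ∀ a b : Circle,
    l * ‖(a : ℂ) - (b : ℂ)‖ ≤ ‖f a - f b‖ ∧ ‖f a - f b‖ ≤ L * ‖(a : ℂ) - (b : ℂ)‖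

/-- The winding map `r e^{iθ} ↦ r e^{2iθ}` of the plane, written as `z ↦ z² / |z|`
(with value `0` at `0`). -/
noncomputable def windingMap (z : ℂ) : ℂ := z ^ 2 / (‖z‖ : ℂ)

theorem windingMap_polar (r θ : ℝ) (hr : 0 ≤ r) :
    windingMap (r * Complex.exp (θ * Complex.I)) = r * Complex.exp (2 * θ * Complex.I) := by
  rcases hr.eq_or_lt with h | h
  · subst h
    simp [windingMap]
  · have h0 : (r : ℂ) ≠ 0 := by exact_mod_cast h.ne'
    have he : Complex.exp (2 * θ * Complex.I) = Complex.exp (θ * Complex.I) ^ 2 := by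
      rw [← Complex.exp_nat_mul]
      congr 1
      push_cast
      ring
    have hn : ‖(r : ℂ) * Complex.exp (θ * Complex.I)‖ = r := by
      rw [norm_mul, Complex.norm_exp_ofReal_mul_I, mul_one, Complex.norm_real,
        Real.norm_of_nonneg hr]
    rw [windingMap, hn, he]
    field_simp

/-- On the unit circle the winding map is squaring in the circle group. -/
theorem windingMap_circle (z : Circle) : windingMap (z : ℂ) = ((z ^ 2 : Circle) : ℂ) := by
  simp [windingMap, Circle.norm_coe]

/-- The region enclosed by a plane set `Γ`: the points off `Γ` whose component in the complement
of `Γ` is bounded. For a Jordan curve this is the domain bounded by the curve; a point lies in it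
exactly when `Γ` separates the point from infinity. -/
def enclosedRegion (Γ : Set ℂ) : Set ℂ :=
  {w | w ∉ Γ ∧ Bornology.IsBounded (connectedComponentIn Γᶜ w)}

/-- `w₀` is an incenter of `Ω`: it is the center of a disk contained in `Ω` whose radius is the
largest among all disks contained in `Ω`. -/
def IsIncenter (Ω : Set ℂ) (w₀ : ℂ) : Prop :=
  ∃ R : ℝ, 0 < R ∧ Metric.ball w₀ R ⊆ Ω ∧
    ∀ (w : ℂ) (r : ℝ), Metric.ball w r ⊆ Ω → r ≤ R

/-- `g` is a winding symmetrization of `f`. Here `f` is a homeomorphism of the circle onto a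
curve which omits `0` and separates `0` from infinity, `g` is a homeomorphism of the circle onto
a curve which omits `0`, and `f ∘ W = W ∘ g` for the winding map `W`
(which is `z ↦ z ^ 2` on the circle). -/
structure IsWindingSymmetrization (f g : Circle → ℂ) : Prop where
  isEmbedding_left : Topology.IsEmbedding f
  zero_mem_enclosed : (0 : ℂ) ∈ enclosedRegion (Set.range f)
  isEmbedding_right : Topology.IsEmbedding g
  right_ne_zero : ∀ z : Circle, g z ≠ 0
  comp_eq : ∀ z : Circle, f (z ^ 2) = windingMap (g z)

/-! The curve `f - w₀` encloses `0`, so its winding number is odd (`exists_odd_winding`). Halving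
the argument of `f (z ^ 2) - w₀` therefore gives a lift `g` with `g (-z) = -g z`
(`exists_odd_lift_windingMap`).

Upper bound: the winding map does not decrease distances between points at angle at most `π / 2`.
Hence `g` is locally `2 * L`-Lipschitz in arc length, and so globally; arc is at most `π / 2` times
chord.

Lower bound: the winding map is 2-Lipschitz, so `2 * ‖g a - g b‖ ≥ l * ‖a - b‖ * ‖a + b‖`, which
suffices unless `b` is near `-a`. In that case `g a + g b` is small by oddness and the upper bound,
while `‖g b‖` is at least the inradius.

The inradius is at least `l / √2` (`IsBiLipschitz.exists_ball_subset`): a coordinatewise Lipschitz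
extension of the inverse of `f` must vanish somewhere in the enclosed region. The plane topology,
including Jordan separation, is derived from continuous logarithms. -/

open Complex Set Filter Topology

/-! ### Continuous logarithms. -/

/-- A nowhere vanishing continuous function on a simply connected, locally path connected space
has a continuous logarithm. -/
theorem exists_continuous_log {A : Type*} [TopologicalSpace A] [SimplyConnectedSpace A]
    [LocallyPathConnectedSpace A] {f : A → ℂ} (hf : Continuous f) (h0 : ∀ a, f a ≠ 0) :
    ∃ φ : A → ℂ, Continuous φ ∧ ∀ a, exp (φ a) = f a := by
  obtain ⟨a⟩ : Nonempty A := inferInstance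
  obtain ⟨F, ⟨-, hF⟩, -⟩ := isCoveringMapOn_exp.existsUnique_continuousMap_lifts
    (⟨f, hf⟩ : C(A, ℂ)) (a₀ := a) (e₀ := log (f a)) (exp_log (h0 a)) (fun a => h0 a)
  exact ⟨F, F.continuous, fun a => congrFun hF a⟩

/-- Two continuous logarithms of the same function on a preconnected set differ by a constant. -/
theorem sub_eq_sub_of_exp_eq_exp {A : Type*} [TopologicalSpace A] {S : Set A}
    (hS : IsPreconnected S) {φ ψ : A → ℂ} (hφ : ContinuousOn φ S) (hψ : ContinuousOn ψ S)
    (h : ∀ x ∈ S, exp (φ x) = exp (ψ x)) {x y : A} (hx : x ∈ S) (hy : y ∈ S) :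
    φ x - ψ x = φ y - ψ y := by
  have : DiscreteTopology (AddSubgroup.zmultiples (2 * Real.pi * I : ℂ) : Set ℂ) :=
    NormedSpace.discreteTopology_zmultiples _
  refine hS.constant_of_mapsTo (T := (AddSubgroup.zmultiples (2 * Real.pi * I : ℂ) : Set ℂ)) (f := fun x => φ x - ψ x)
    ⟨this⟩ (hφ.sub hψ) (fun z hz => ?_) hx hy
  obtain ⟨n, hn⟩ := exp_eq_exp_iff_exists_int.1 (h z hz)
  exact AddSubgroup.mem_zmultiples_iff.2 ⟨n, by simp [hn]⟩

/-- A logarithm of `c * exp (t * I)` does not have the same value at `0` and `2 * π`. -/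
theorem ne_of_exp_eq_const_mul_exp {μ : ℝ → ℂ} (hμ : Continuous μ) (c : ℂ)
    (h : ∀ t, exp (μ t) = c * exp (t * I)) : μ (2 * Real.pi) ≠ μ 0 := by
  intro h2
  have hc : c ≠ 0 := by
    rintro rfl
    exact exp_ne_zero _ ((h 0).trans (zero_mul _))
  have := sub_eq_sub_of_exp_eq_exp isPreconnected_univ (φ := μ)
    (ψ := fun t : ℝ => log c + t * I) hμ.continuousOn (by fun_prop)
    (fun t _ => by rw [h, exp_add, exp_log hc]) (mem_univ (2 * Real.pi)) (mem_univ 0)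
  simp [h2] at this

/-! ### Enclosed regions and logarithms on compact plane sets. -/

theorem isPreconnected_Ici_smul (w : ℂ) : IsPreconnected ((fun s : ℝ => s • w) '' Ici 1) :=
  isPreconnected_Ici.image _ (by fun_prop)

theorem not_isBounded_of_ray {w : ℂ} (hw : w ≠ 0) {S : Set ℂ}
    (h : (fun s : ℝ => s • w) '' Ici 1 ⊆ S) : ¬ Bornology.IsBounded S := by
  intro hb
  obtain ⟨r, hr⟩ := (hb.subset h).exists_norm_le
  have hw' : 0 < ‖w‖ := norm_pos_iff.2 hw
  have h1 := hr _ ⟨1 + |r| / ‖w‖, by simp; positivity, rfl⟩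
  simp only [norm_smul, Real.norm_eq_abs] at h1
  rw [abs_of_pos (by positivity), add_mul, div_mul_cancel₀ _ hw'.ne'] at h1
  linarith [le_abs_self r]

section Plane
variable {K : Set ℂ}

theorem isOpen_enclosedRegion (hK : IsClosed K) : IsOpen (enclosedRegion K) := by
  rw [isOpen_iff_mem_nhds]
  rintro w ⟨hw, hb⟩
  refine mem_of_superset (hK.isOpen_compl.connectedComponentIn.mem_nhds
    (mem_connectedComponentIn hw)) fun y hy => ⟨connectedComponentIn_subset _ _ hy, ?_⟩
  rwa [← connectedComponentIn_eq hy]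

theorem isClosed_enclosedRegion_union (hK : IsClosed K) : IsClosed (enclosedRegion K ∪ K) := by
  rw [← isOpen_compl_iff, isOpen_iff_mem_nhds]
  intro w hw
  have hwK : w ∉ K := fun h => hw (Or.inr h)
  refine mem_of_superset (hK.isOpen_compl.connectedComponentIn.mem_nhds
    (mem_connectedComponentIn hwK)) fun y hy => ?_
  rintro (h | h)
  · exact hw (Or.inl ⟨hwK, by rw [connectedComponentIn_eq hy]; exact h.2⟩)
  · exact connectedComponentIn_subset _ _ hy h

theorem closure_enclosedRegion_subset (hK : IsClosed K) :
    closure (enclosedRegion K) ⊆ enclosedRegion K ∪ K :=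
  closure_minimal subset_union_left (isClosed_enclosedRegion_union hK)

theorem enclosedRegion_subset_closedBall {r : ℝ} (hr : 0 ≤ r) (h : K ⊆ Metric.closedBall 0 r) :
    enclosedRegion K ⊆ Metric.closedBall 0 r := by
  rintro w ⟨hwK, hb⟩
  by_contra hw
  simp only [Metric.mem_closedBall, dist_zero_right, not_le] at hw
  have hw0 : w ≠ 0 := norm_pos_iff.1 (hr.trans_lt hw)
  refine not_isBounded_of_ray hw0 ?_ hb
  refine (isPreconnected_Ici_smul w).subset_connectedComponentIn ⟨1, by simp, by simp⟩ ?_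
  rintro _ ⟨s, hs, rfl⟩ hK
  have := h hK
  simp only [Metric.mem_closedBall, dist_zero_right, norm_smul, Real.norm_eq_abs] at this
  have hs1 : 1 ≤ |s| := le_trans hs (le_abs_self s)
  nlinarith [norm_nonneg w]

theorem isBounded_enclosedRegion (hK : Bornology.IsBounded K) :
    Bornology.IsBounded (enclosedRegion K) := by
  obtain ⟨r, hr⟩ := hK.subset_closedBall 0
  exact Metric.isBounded_closedBall.subset (enclosedRegion_subset_closedBall (abs_nonneg r)
    (hr.trans (Metric.closedBall_subset_closedBall (le_abs_self r))))

/-- A continuous self-map of the plane which is the identity off a bounded set is surjective. -/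
theorem surjective_of_eq_id_of_norm_ge {H : ℂ → ℂ} (hH : Continuous H) {r : ℝ}
    (h : ∀ z, r ≤ ‖z‖ → H z = z) : Function.Surjective H := by
  intro w
  by_contra! hw
  obtain ⟨φ, hφ, he⟩ := exists_continuous_log (hH.sub (continuous_const (y := w)))
    (fun z => sub_ne_zero.2 (hw z))
  -- On the circle of radius `|r| + ‖w‖` about `w` all norms are at least `r`, so `H` is the
  -- identity there.
  have hR : ∀ t : ℝ, exp (φ (w + (|r| + ‖w‖ : ℝ) * exp (t * I))) =
      ((|r| + ‖w‖ : ℝ) : ℂ) * exp (t * I) := by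
    intro t
    rw [he, Pi.sub_apply, h, add_sub_cancel_left]
    have h1 : ‖((|r| + ‖w‖ : ℝ) : ℂ) * exp (t * I)‖ = |r| + ‖w‖ := by
      rw [norm_mul, norm_exp_ofReal_mul_I, mul_one, norm_real, Real.norm_of_nonneg (by positivity)]
    have h2 := norm_sub_le (w + ((|r| + ‖w‖ : ℝ) : ℂ) * exp (t * I)) w
    rw [add_sub_cancel_left, h1] at h2
    linarith [le_abs_self r]
  refine ne_of_exp_eq_const_mul_exp (by fun_prop) _ hR ?_
  simp

/-- A continuous map of the closed region enclosed by `K` which fixes `K` pointwise covers the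
region. -/
theorem enclosedRegion_subset_image (hK : IsCompact K) {A : ℂ → ℂ}
    (hA : ContinuousOn A (enclosedRegion K ∪ K)) (hid : ∀ z ∈ K, A z = z) :
    enclosedRegion K ⊆ A '' enclosedRegion K := by
  classical
  intro w hw
  have hfr : ∀ a ∈ frontier (enclosedRegion K), A a = id a := by
    intro a ha
    rw [frontier, (isOpen_enclosedRegion hK.isClosed).interior_eq] at ha
    exact hid a ((closure_enclosedRegion_subset hK.isClosed ha.1).resolve_left ha.2)
  have hc : Continuous ((enclosedRegion K).piecewise A id) :=
    continuous_piecewise hfr (hA.mono (closure_enclosedRegion_subset hK.isClosed))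
      continuousOn_id
  obtain ⟨r, hr⟩ := (isBounded_enclosedRegion hK.isBounded).exists_norm_le
  obtain ⟨z, hz⟩ := surjective_of_eq_id_of_norm_ge hc (r := r + 1) (fun z hz => by
    rw [piecewise_eq_of_notMem]
    · rfl
    · intro hmem
      linarith [hr z hmem]) w
  by_cases hzΩ : z ∈ enclosedRegion K
  · rw [piecewise_eq_of_mem _ _ _ hzΩ] at hz
    exact ⟨z, hzΩ, hz⟩
  · rw [piecewise_eq_of_notMem _ _ _ hzΩ] at hz
    exact absurd (hz ▸ hw : id z ∈ enclosedRegion K) hzΩ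

/-- A compact subset of the plane enclosing `0` carries no continuous logarithm. -/
theorem not_exists_log_of_zero_mem_enclosedRegion {X : Type*} [TopologicalSpace X]
    [CompactSpace X] {e : X → ℂ} (he : IsClosedEmbedding e)
    (h0 : (0 : ℂ) ∈ enclosedRegion (range e)) {ψ : X → ℂ} (hψ : Continuous ψ) :
    ¬ ∀ x, exp (ψ x) = e x := by
  intro h
  -- With `Ψ` a Tietze extension of the logarithm, `exp ∘ Ψ` fixes the set pointwise, so it would
  -- have to take the value `0`.
  obtain ⟨Ψ, hΨ⟩ := ContinuousMap.exists_extension' he (⟨ψ, hψ⟩ : C(X, ℂ))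
  obtain ⟨z, -, hz⟩ := enclosedRegion_subset_image (isCompact_range he.continuous)
    (A := fun z => exp (Ψ z)) (by fun_prop) (by
      rintro _ ⟨x, rfl⟩
      exact (congrArg exp (congrFun hΨ x)).trans (h x)) h0
  exact exp_ne_zero _ hz

/-- `z ↦ z - p` has a continuous logarithm on `K`. -/
def HasLogOn (K : Set ℂ) (p : ℂ) : Prop :=
  ∃ ψ : ℂ → ℂ, ContinuousOn ψ K ∧ ∀ z ∈ K, exp (ψ z) = z - p

/-- Write `z - q = (z - p) * (1 + (p - q) / (z - p))`; the second factor lies in the unit disk about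
`1`, where the principal logarithm is continuous. -/
theorem HasLogOn.of_norm_lt {p q : ℂ} (h : HasLogOn K p) (hpq : ∀ z ∈ K, ‖p - q‖ < ‖z - p‖) :
    HasLogOn K q := by
  obtain ⟨ψ, hψ, he⟩ := h
  have h1 : ∀ z ∈ K, z - p ≠ 0 := fun z hz h0 => by
    have := hpq z hz
    rw [h0, norm_zero] at this
    exact absurd this (norm_nonneg _).not_gt
  have h2 : ∀ z ∈ K, 1 + (p - q) / (z - p) ∈ slitPlane := fun z hz =>
    mem_slitPlane_of_norm_lt_one (by
      rw [norm_div, div_lt_one ((norm_nonneg _).trans_lt (hpq z hz))]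
      exact hpq z hz)
  refine ⟨fun z => ψ z + log (1 + (p - q) / (z - p)), hψ.add (ContinuousOn.clog ?_ h2), ?_⟩
  · exact continuousOn_const.add (continuousOn_const.div (by fun_prop) h1)
  · intro z hz
    rw [exp_add, he z hz, exp_log (slitPlane_ne_zero (h2 z hz))]
    field_simp [h1 z hz]
    ring

theorem hasLogOn_of_norm_lt {p : ℂ} (hp : ∀ z ∈ K, ‖z‖ < ‖p‖) : HasLogOn K p := by
  rcases eq_or_ne p 0 with rfl | hp0
  · exact ⟨0, continuousOn_const, fun z hz => absurd (hp z hz) (by simp)⟩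
  have h2 : ∀ z ∈ K, 1 + -z / p ∈ slitPlane := fun z hz =>
    mem_slitPlane_of_norm_lt_one (by
      rw [norm_div, norm_neg, div_lt_one (norm_pos_iff.2 hp0)]
      exact hp z hz)
  refine ⟨fun z => log (-p) + log (1 + -z / p), continuousOn_const.add
    (ContinuousOn.clog (by fun_prop) h2), fun z hz => ?_⟩
  rw [exp_add, exp_log (neg_ne_zero.2 hp0), exp_log (slitPlane_ne_zero (h2 z hz))]
  field_simp
  ring

/-- A point which is neither on nor enclosed by the compact set `K` can be moved to infinity,
so `z ↦ z - p` has a continuous logarithm on `K`. -/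
theorem hasLogOn_of_notMem (hK : IsCompact K) {p : ℂ} (hp : p ∉ K) (hp' : p ∉ enclosedRegion K) :
    HasLogOn K p := by
  have hub : ¬ Bornology.IsBounded (connectedComponentIn Kᶜ p) := fun h => hp' ⟨hp, h⟩
  obtain ⟨r, hr⟩ := hK.isBounded.exists_norm_le
  obtain ⟨q, hq, hqr⟩ : ∃ q ∈ connectedComponentIn Kᶜ p, r < ‖q‖ := by
    by_contra! hcon
    exact hub (isBounded_iff_forall_norm_le.2 ⟨r, hcon⟩)
  have hqlog : HasLogOn K q := hasLogOn_of_norm_lt fun z hz => (hr z hz).trans_lt hqr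
  refine (isPreconnected_connectedComponentIn (F := Kᶜ) (x := p)).induction₂
    (fun x y => HasLogOn K x ↔ HasLogOn K y) ?_ (fun _ _ _ _ _ _ h h' => h.trans h')
    (fun _ _ _ _ h => h.symm) hq (mem_connectedComponentIn hp) |>.1 hqlog
  intro x hx
  have hxK : x ∈ Kᶜ := connectedComponentIn_subset _ _ hx
  obtain ⟨ε, hε, hb⟩ := Metric.isOpen_iff.1 hK.isClosed.isOpen_compl x hxK
  -- Half the distance scale lets the perturbation run both ways: `K` stays farther than `‖x - y‖`
  -- from `x` and from `y`.
  filter_upwards [mem_nhdsWithin_of_mem_nhds (Metric.ball_mem_nhds x (half_pos hε))] with y hy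
  have hy' : ‖x - y‖ < ε / 2 := by rw [← dist_eq_norm, dist_comm]; exact hy
  have hz : ∀ z ∈ K, ε ≤ ‖z - x‖ := fun z hz => by
    by_contra! hlt
    exact hb (by rwa [Metric.mem_ball, dist_eq_norm]) hz
  constructor
  · exact fun h => h.of_norm_lt fun z hzK => by linarith [hz z hzK]
  · refine fun h => h.of_norm_lt fun z hzK => ?_
    have := hz z hzK
    have h3 : ‖z - x‖ ≤ ‖z - y‖ + ‖y - x‖ := norm_sub_le_norm_sub_add_norm_sub _ _ _
    rw [norm_sub_rev y x] at h3 ⊢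
    linarith

/-- A compact connected set which is disjoint from its reflection does not enclose `0`. -/
theorem zero_notMem_enclosedRegion (hK : IsCompact K) (hc : IsConnected K)
    (hneg : ∀ z ∈ K, -z ∉ K) : (0 : ℂ) ∉ enclosedRegion K := by
  rintro ⟨h0, hb⟩
  -- Escape route from `0` avoiding `K`: the segment to `-q` with `q` nearest to `0`, then `-K`,
  -- then the outward ray from `-p` with `p` farthest.
  obtain ⟨q, hq, hqmin⟩ := hK.exists_isMinOn hc.nonempty continuous_norm.continuousOn
  obtain ⟨p, hp, hpmax⟩ := hK.exists_isMaxOn hc.nonempty continuous_norm.continuousOn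
  have hp0 : p ≠ 0 := fun h => h0 (h ▸ hp)
  have hq0 : 0 < ‖q‖ := norm_pos_iff.2 fun h => h0 (h ▸ hq)
  have hseg : (fun s : ℝ => s • -q) '' Icc 0 1 ⊆ connectedComponentIn Kᶜ 0 := by
    refine (isPreconnected_Icc.image _ (by fun_prop)).subset_connectedComponentIn
      ⟨0, by simp, by simp⟩ ?_
    rintro _ ⟨s, ⟨hs0, hs1⟩, rfl⟩ hmem
    rcases hs1.eq_or_lt with rfl | hs
    · exact hneg q hq (by simpa using hmem)
    · have h1 : ‖q‖ ≤ ‖s • -q‖ := hqmin hmem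
      rw [norm_smul, norm_neg, Real.norm_of_nonneg hs0] at h1
      nlinarith
  have hnegK : Neg.neg '' K ⊆ connectedComponentIn Kᶜ 0 := by
    rw [connectedComponentIn_eq (hseg ⟨1, by simp, rfl⟩)]
    refine (hc.isPreconnected.image _ continuous_neg.continuousOn).subset_connectedComponentIn
      ⟨q, hq, by simp⟩ ?_
    rintro _ ⟨z, hz, rfl⟩
    exact hneg z hz
  refine not_isBounded_of_ray (neg_ne_zero.2 hp0) ?_ hb
  rw [connectedComponentIn_eq (hnegK ⟨p, hp, rfl⟩)]
  refine (isPreconnected_Ici_smul (-p)).subset_connectedComponentIn ⟨1, by simp, by simp⟩ ?_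
  rintro _ ⟨s, hs, rfl⟩ hmem
  rcases (show 1 ≤ s from hs).eq_or_lt with rfl | hs
  · exact hneg p hp (by simpa using hmem)
  · have h1 : ‖s • -p‖ ≤ ‖p‖ := hpmax hmem
    rw [norm_smul, norm_neg, Real.norm_of_nonneg (by linarith)] at h1
    nlinarith [norm_pos_iff.2 hp0]

end Plane

/-! ### Separation of the plane by a Jordan curve. -/

/-- The change of `log (γ - z)` along a path `γ`, as a continuous function of the point `z` off
the path. -/
theorem exists_log_change {γ : ℝ → ℂ} (hγ : Continuous γ) {a b : ℝ} (hab : a ≤ b) :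
    ∃ Λ : ℂ → ℂ, ContinuousOn Λ (γ '' Icc a b)ᶜ ∧ ∀ z ∉ γ '' Icc a b,
      exp (Λ z) = (γ b - z) / (γ a - z) ∧
      ∀ φ : ℝ → ℂ, ContinuousOn φ (Icc a b) → (∀ t ∈ Icc a b, exp (φ t) = γ t - z) →
        Λ z = φ b - φ a := by
  have hex : ∀ z, ∃ φ : ℝ → ℂ, z ∉ γ '' Icc a b →
      Continuous φ ∧ ∀ t ∈ Icc a b, exp (φ t) = γ t - z := by
    intro z
    by_cases hz : z ∈ γ '' Icc a b
    · exact ⟨0, fun h => absurd hz h⟩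
    obtain ⟨φ, hφ, he⟩ := exists_continuous_log
      (f := fun t : ℝ => γ (projIcc a b hab t) - z) (by fun_prop)
      (fun t h0 => hz ⟨_, (projIcc a b hab t).2, sub_eq_zero.1 h0⟩)
    exact ⟨φ, fun _ => ⟨hφ, fun t ht => by rw [he, projIcc_of_mem hab ht]⟩⟩
  choose φ hφ using hex
  have ha : a ∈ Icc a b := left_mem_Icc.2 hab
  have hb : b ∈ Icc a b := right_mem_Icc.2 hab
  have huniq : ∀ z ∉ γ '' Icc a b, ∀ ψ : ℝ → ℂ, ContinuousOn ψ (Icc a b) →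
      (∀ t ∈ Icc a b, exp (ψ t) = γ t - z) → φ z b - φ z a = ψ b - ψ a := by
    intro z hz ψ hψ he
    linear_combination sub_eq_sub_of_exp_eq_exp isPreconnected_Icc (hφ z hz).1.continuousOn hψ
      (fun t ht => ((hφ z hz).2 t ht).trans (he t ht).symm) hb ha
  refine ⟨fun z => φ z b - φ z a, fun z hz => ContinuousAt.continuousWithinAt ?_, fun z hz =>
    ⟨by rw [exp_sub, (hφ z hz).2 b hb, (hφ z hz).2 a ha], huniq z hz⟩⟩
  obtain ⟨ε, hε, hball⟩ := Metric.isOpen_iff.1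
    (isCompact_Icc.image hγ).isClosed.isOpen_compl z hz
  have hne : ∀ t ∈ Icc a b, ε ≤ ‖γ t - z‖ := fun t ht => by
    by_contra! hlt
    exact hball (by rwa [Metric.mem_ball, dist_eq_norm]) ⟨t, ht, rfl⟩
  have hne0 : ∀ t ∈ Icc a b, γ t - z ≠ 0 := fun t ht =>
    norm_pos_iff.1 (hε.trans_le (hne t ht))
  have hslit : ∀ w ∈ Metric.ball z ε, ∀ t ∈ Icc a b, 1 + (z - w) / (γ t - z) ∈ slitPlane := by
    intro w hw t ht
    refine mem_slitPlane_of_norm_lt_one ?_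
    rw [norm_div, div_lt_one (hε.trans_le (hne t ht)), ← dist_eq_norm, dist_comm]
    exact (Metric.mem_ball.1 hw).trans_le (hne t ht)
  -- Near `z`, the fixed lift `φ z` plus a principal logarithm is a lift for `w`, and its change
  -- depends continuously on `w`.
  have hev : (fun w => φ z b + log (1 + (z - w) / (γ b - z)) -
      (φ z a + log (1 + (z - w) / (γ a - z)))) =ᶠ[𝓝 z] fun w => φ w b - φ w a := by
    filter_upwards [Metric.ball_mem_nhds z hε] with w hw
    refine (huniq w (hball hw) (fun t => φ z t + log (1 + (z - w) / (γ t - z)))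
      ((hφ z hz).1.continuousOn.add (ContinuousOn.clog ?_ (hslit w hw))) fun t ht => ?_).symm
    · exact continuousOn_const.add (continuousOn_const.div (by fun_prop) hne0)
    · rw [exp_add, (hφ z hz).2 t ht, exp_log (slitPlane_ne_zero (hslit w hw t ht))]
      have := hne0 t ht
      field_simp
      ring
  refine ContinuousAt.congr (ContinuousAt.sub ?_ ?_) hev
  · exact continuousAt_const.add (ContinuousAt.clog (by fun_prop)
      (hslit z (Metric.mem_ball_self hε) b hb))
  · exact continuousAt_const.add (ContinuousAt.clog (by fun_prop)
      (hslit z (Metric.mem_ball_self hε) a ha))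

/-- The quotient `(q - z) / (p - z)` has no continuous logarithm on the plane without the two
points `p ≠ q`. -/
theorem not_continuousOn_log_div {p q : ℂ} (hpq : p ≠ q) {Λ : ℂ → ℂ}
    (h : ∀ z, z ≠ p → z ≠ q → exp (Λ z) = (q - z) / (p - z)) :
    ¬ ContinuousOn Λ {p, q}ᶜ := by
  intro hΛ
  set d : ℂ := (q - p) / 2
  have hd : d ≠ 0 := div_ne_zero (sub_ne_zero.2 hpq.symm) two_ne_zero
  have hqd : q = p + 2 * d := by simp only [d]; ring
  have hnorm : ∀ t : ℝ, ‖exp (t * I) / 2‖ < 1 := fun t => by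
    rw [norm_div, norm_exp_ofReal_mul_I]; norm_num
  have hslit : ∀ t : ℝ, 1 + -(exp (t * I) / 2) ∈ slitPlane := fun t =>
    mem_slitPlane_of_norm_lt_one (by rw [norm_neg]; exact hnorm t)
  have hzp : ∀ t : ℝ, p + d * exp (t * I) ≠ p := fun t => by
    simp [hd]
  have hzq : ∀ t : ℝ, p + d * exp (t * I) ≠ q := fun t heq => by
    rw [hqd, add_right_inj, mul_comm 2 d, mul_right_inj' hd] at heq
    have := norm_exp_ofReal_mul_I t
    rw [heq] at this
    norm_num at this
  have hc : Continuous fun t : ℝ => log (1 + -(exp (t * I) / 2)) - Λ (p + d * exp (t * I)) :=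
    (Continuous.clog (by fun_prop) hslit).sub (hΛ.comp_continuous (by fun_prop)
      fun t => by simpa using ⟨by simp [hd], hzq t⟩)
  -- On the circle about `p` through the midpoint of `p` and `q`, the quotient is `-(2 - e) / e`
  -- with `e = exp (t * I)`; dividing `1 - e / 2` by it leaves `-e / 2`.
  refine ne_of_exp_eq_const_mul_exp hc (-1 / 2) (fun t => ?_) (by simp)
  rw [exp_sub, exp_log (slitPlane_ne_zero (hslit t)), h _ (hzp t) (hzq t), hqd]
  have h1 : 2 - exp (t * I) ≠ 0 := fun h0 => hzq t (by rw [hqd]; linear_combination -d * h0)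
  have h2 := exp_ne_zero (t * I)
  rw [show p + 2 * d - (p + d * exp (t * I)) = d * (2 - exp (t * I)) by ring,
    show p - (p + d * exp (t * I)) = -(d * exp (t * I)) by ring]
  field_simp
  ring

/-- A Jordan curve separates the plane. -/
theorem enclosedRegion_range_nonempty {f : Circle → ℂ} (hf : Continuous f)
    (hinj : Function.Injective f) : (enclosedRegion (range f)).Nonempty := by
  by_contra hemp
  rw [not_nonempty_iff_eq_empty] at hemp
  have hcomp : IsCompact (range f) := isCompact_range hf
  have hlog : ∀ z ∉ range f, HasLogOn (range f) z := fun z hz =>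
    hasLogOn_of_notMem hcomp hz (by simp [hemp])
  set γ : ℝ → ℂ := fun t => f (Circle.exp t) with hγdef
  have hγ : Continuous γ := hf.comp Circle.exp.continuous
  have hpi := Real.pi_pos
  obtain ⟨Λ₁, hΛ₁, h₁⟩ := exists_log_change hγ (a := 0) (b := Real.pi) hpi.le
  obtain ⟨Λ₂, hΛ₂, h₂⟩ := exists_log_change hγ (a := Real.pi) (b := 2 * Real.pi) (by linarith)
  set A := γ '' Icc 0 Real.pi
  set B := γ '' Icc Real.pi (2 * Real.pi)
  have hAc : IsOpen Aᶜ := (isCompact_Icc.image hγ).isClosed.isOpen_compl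
  have hBc : IsOpen Bᶜ := (isCompact_Icc.image hγ).isClosed.isOpen_compl
  have h2pi : γ (2 * Real.pi) = γ 0 := by simp [hγdef]
  have hγinj : ∀ s t : ℝ, γ s = γ t → ∃ n : ℤ, s = t + n * (2 * Real.pi) := fun s t h =>
    Circle.exp_eq_exp.1 (hinj h)
  have hAB : ∀ z ∈ A, z ∈ B → z = γ 0 ∨ z = γ Real.pi := by
    rintro _ ⟨s, hs, rfl⟩ ⟨t, ht, hts⟩
    obtain ⟨n, hn⟩ := hγinj t s hts
    have h1 : -1 < n := by
      have : (-1 : ℝ) < n := by nlinarith [hs.1, hs.2, ht.1, ht.2]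
      exact_mod_cast this
    have h2 : n < 2 := by
      have : (n : ℝ) < 2 := by nlinarith [hs.1, hs.2, ht.1, ht.2]
      exact_mod_cast this
    interval_cases n
    · right
      congr 1
      simp at hn
      linarith [hs.2, ht.1]
    · left
      congr 1
      simp at hn
      linarith [hs.1, ht.2]
  have hpq : γ 0 ≠ γ Real.pi := fun h => by
    obtain ⟨n, hn⟩ := hγinj _ _ h
    have : (0 : ℝ) = 1 + n * 2 := by
      have : Real.pi * (1 + n * 2) = 0 := by linarith
      simpa [hpi.ne', eq_comm] using this
    have : (0 : ℤ) = 1 + n * 2 := by exact_mod_cast this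
    omega
  have hrange : ∀ z ∈ range f, z ∈ A ∨ z ∈ B := by
    rintro _ ⟨x, rfl⟩
    obtain ⟨t, ht, rfl⟩ : ∃ t ∈ Ico 0 (2 * Real.pi), Circle.exp t = x := by
      obtain ⟨t, ht, h⟩ := Circle.periodic_exp.exists_mem_Ico₀ (by positivity) (arg (x : ℂ))
      exact ⟨t, ht, by rw [← h, Circle.exp_arg]⟩
    rcases le_total t Real.pi with h | h
    · exact Or.inl ⟨t, ⟨ht.1, h⟩, rfl⟩
    · exact Or.inr ⟨t, ⟨h, ht.2.le⟩, rfl⟩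
  -- A logarithm on the whole curve has zero total change. Thus `Λ₁` off `A` and `-Λ₂` off `B` glue
  -- to a forbidden logarithm off the two endpoints.
  have heq : ∀ z, z ∉ A → z ∉ B → Λ₁ z = -Λ₂ z := by
    intro z hzA hzB
    obtain ⟨ψ, hψ, he⟩ := hlog z fun h => (hrange z h).elim hzA hzB
    have hc : Continuous fun t => ψ (γ t) := hψ.comp_continuous hγ fun t => ⟨_, rfl⟩
    rw [(h₁ z hzA).2 _ hc.continuousOn fun t _ => he _ ⟨_, rfl⟩,
      (h₂ z hzB).2 _ hc.continuousOn fun t _ => he _ ⟨_, rfl⟩]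
    simp only [h2pi]
    ring
  classical
  refine not_continuousOn_log_div hpq (Λ := fun z => if z ∈ A then -Λ₂ z else Λ₁ z) ?_ ?_
  · intro z hzp hzq
    by_cases hzA : z ∈ A
    · have hzB : z ∉ B := fun hzB => (hAB z hzA hzB).elim hzp hzq
      simp only [hzA, if_true]
      rw [exp_neg, (h₂ z hzB).1, inv_div, h2pi]
    · simp only [hzA, if_false]
      exact (h₁ z hzA).1
  · intro z hz
    refine ContinuousAt.continuousWithinAt ?_
    by_cases hzA : z ∈ A
    · have hzB : z ∉ B := fun hzB => hz (hAB z hzA hzB)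
      refine (hΛ₂.continuousAt (hBc.mem_nhds hzB)).neg.congr ?_
      filter_upwards [hBc.mem_nhds hzB] with w hw
      by_cases hwA : w ∈ A
      · simp [hwA]
      · simp [hwA, heq w hwA hw]
    · refine (hΛ₁.continuousAt (hAc.mem_nhds hzA)).congr ?_
      filter_upwards [hAc.mem_nhds hzA] with w hw
      simp [show w ∉ A from hw]

/-! ### Inradius and incenters. -/

namespace IsBiLipschitz
variable {L l : ℝ} {f : Circle → ℂ}

theorem injective (hf : IsBiLipschitz L l f) : Function.Injective f := by
  intro a b hab
  have h := (hf.2.2 a b).1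
  rw [hab, sub_self, norm_zero] at h
  have h0 : ‖(a : ℂ) - b‖ ≤ 0 := nonpos_of_mul_nonpos_right h hf.2.1
  exact Circle.ext (sub_eq_zero.1 (norm_le_zero_iff.1 h0))

theorem continuous (hf : IsBiLipschitz L l f) : Continuous f :=
  (LipschitzWith.of_dist_le_mul (K := ⟨L, hf.1.le⟩) fun a b => by
    rw [dist_eq_norm]
    exact (hf.2.2 a b).2.trans_eq (congrArg (L * ·) (dist_eq_norm (a : ℂ) b).symm)).continuous

theorem isEmbedding (hf : IsBiLipschitz L l f) : IsEmbedding f :=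
  (hf.continuous.isClosedEmbedding hf.injective).isEmbedding

theorem le (hf : IsBiLipschitz L l f) : l ≤ L := by
  have h := hf.2.2 1 (Circle.exp Real.pi)
  have h1 : ‖((1 : Circle) : ℂ) - (Circle.exp Real.pi : ℂ)‖ = 2 := by
    simp
    norm_num
  rw [h1] at h
  linarith [h.1.trans h.2]

end IsBiLipschitz

theorem ball_subset_enclosedRegion {K : Set ℂ} {w : ℂ} {r : ℝ} (hw : w ∈ enclosedRegion K)
    (h : ∀ z ∈ K, r ≤ ‖z - w‖) : Metric.ball w r ⊆ enclosedRegion K := by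
  intro y hy
  have hr : 0 < r := dist_nonneg.trans_lt hy
  have hsub : Metric.ball w r ⊆ Kᶜ := fun z hz hzK => by
    rw [Metric.mem_ball, dist_eq_norm] at hz
    exact (h z hzK).not_gt hz
  have hyc := (convex_ball w r).isPreconnected.subset_connectedComponentIn
    (Metric.mem_ball_self hr) hsub hy
  exact ⟨hsub hy, by rw [← connectedComponentIn_eq hyc]; exact hw.2⟩

/-- A Lipschitz function on the image of the circle, composed with the inverse of a bi-Lipschitz
map, extends to the plane. -/
theorem IsBiLipschitz.exists_extend {L l : ℝ} {f : Circle → ℂ} (hf : IsBiLipschitz L l f)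
    (u : ℂ → ℝ) (hu : ∀ a b, |u a - u b| ≤ ‖a - b‖) :
    ∃ U : ℂ → ℝ, Continuous U ∧ (∀ z w, l * |U z - U w| ≤ ‖z - w‖) ∧ ∀ a : Circle, U (f a) = u a := by
  have hl := hf.2.1
  obtain ⟨e, he⟩ : ∃ e : ℂ → Circle, ∀ a, e (f a) = a :=
    ⟨Function.invFun f, Function.leftInverse_invFun hf.injective⟩
  obtain ⟨U, hU, hUf⟩ := LipschitzOnWith.extend_real (f := fun z => u (e z)) (s := range f)
    (K := ⟨l⁻¹, inv_nonneg.2 hl.le⟩) (LipschitzOnWith.of_dist_le_mul (by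
      rintro _ ⟨a, rfl⟩ _ ⟨b, rfl⟩
      rw [he, he, Real.dist_eq, dist_eq_norm]
      refine (hu _ _).trans ?_
      change _ ≤ l⁻¹ * _
      rw [le_inv_mul_iff₀ hl]
      exact (hf.2.2 a b).1))
  refine ⟨U, hU.continuous, fun z w => ?_, fun a => ?_⟩
  · have h : |U z - U w| ≤ l⁻¹ * ‖z - w‖ := by
      rw [← Real.dist_eq, ← dist_eq_norm]
      exact hU.dist_le_mul z w
    rwa [le_inv_mul_iff₀ hl] at h
  · rw [← hUf ⟨a, rfl⟩]
    simp only [he]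

/-- The region enclosed by an `(L, l)`-bi-Lipschitz curve contains a disk of radius `l / √2`. -/
theorem IsBiLipschitz.exists_ball_subset {L l : ℝ} {f : Circle → ℂ} (hf : IsBiLipschitz L l f) :
    ∃ w, Metric.ball w (l / √2) ⊆ enclosedRegion (range f) := by
  have hl := hf.2.1
  have hK : IsCompact (range f) := isCompact_range hf.continuous
  obtain ⟨U, hU, hUl, hUf⟩ := hf.exists_extend re fun a b => by
    rw [← sub_re]; exact abs_re_le_norm _
  obtain ⟨V, hV, hVl, hVf⟩ := hf.exists_extend im fun a b => by
    rw [← sub_im]; exact abs_im_le_norm _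
  set F : ℂ → ℂ := fun z => U z + V z * I with hF
  have hFc : Continuous F := by fun_prop
  have hFf : ∀ a : Circle, F (f a) = a := fun a => by
    simp only [hF, hUf, hVf, re_add_im]
  obtain ⟨fe, hfe⟩ := ContinuousMap.exists_extension'
    (e := fun a : Circle => (a : ℂ))
    (Continuous.isClosedEmbedding (by fun_prop) Circle.coe_injective)
    (⟨f, hf.continuous⟩ : C(Circle, ℂ))
  have hfe' : ∀ a : Circle, fe a = f a := fun a => congrFun hfe a
  -- Without a zero, `f` applied to `F / ‖F‖` would retract the closed region onto the curve.
  obtain ⟨w, hw, hFw⟩ : ∃ w ∈ enclosedRegion (range f), F w = 0 := by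
    by_contra! hne
    have hne' : ∀ z ∈ enclosedRegion (range f) ∪ range f, F z ≠ 0 := by
      rintro z (hz | ⟨a, rfl⟩)
      · exact hne z hz
      · rw [hFf]; exact Circle.coe_ne_zero a
    obtain ⟨w, hw⟩ := enclosedRegion_range_nonempty hf.continuous hf.injective
    obtain ⟨z, hz, hzw⟩ := enclosedRegion_subset_image hK (A := fun z => fe (F z / ‖F z‖))
      (fe.continuous.comp_continuousOn (hFc.continuousOn.div (by fun_prop)
        fun z hz => by simpa using hne' z hz))
      (by
        rintro _ ⟨a, rfl⟩
        simp only [hFf, Circle.norm_coe, ofReal_one, div_one, hfe']) hw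
    refine hw.1 ⟨Circle.exp (arg (F z)), ?_⟩
    rw [← hfe', ← hzw, Circle.coe_exp]
    congr 1
    rw [eq_div_iff (by simpa using hne z hz), mul_comm, norm_mul_exp_arg_mul_I]
  refine ⟨w, ball_subset_enclosedRegion hw ?_⟩
  rintro _ ⟨a, rfl⟩
  have hUw : U w = 0 := by simpa [hF] using congrArg re hFw
  have hVw : V w = 0 := by simpa [hF] using congrArg im hFw
  have h1 := hUl (f a) w
  have h2 := hVl (f a) w
  rw [hUf, hUw, sub_zero] at h1
  rw [hVf, hVw, sub_zero] at h2
  have h3 : (a : ℂ).re ^ 2 + (a : ℂ).im ^ 2 = 1 := by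
    have := Circle.normSq_coe a
    rw [normSq_apply] at this
    linarith
  -- Each coordinate of `a` is at most `‖f a - w‖ / l` in absolute value; summing the two squares
  -- produces `√2`.
  rw [← abs_of_nonneg (norm_nonneg (f a - w)), ← abs_of_pos (show 0 < l / √2 by positivity),
    ← sq_le_sq, div_pow, Real.sq_sqrt zero_le_two]
  have h4 := pow_le_pow_left₀ (by positivity) h1 2
  have h5 := pow_le_pow_left₀ (by positivity) h2 2
  rw [mul_pow, sq_abs] at h4 h5
  nlinarith

/-- A nonempty bounded open set has an incenter. -/
theorem exists_isIncenter {Ω : Set ℂ} (ho : IsOpen Ω) (hb : Bornology.IsBounded Ω)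
    (hne : Ω.Nonempty) : ∃ w, IsIncenter Ω w := by
  have hcne : Ωᶜ.Nonempty := by
    rw [nonempty_compl]
    rintro rfl
    exact NormedSpace.unbounded_univ ℝ ℂ hb
  obtain ⟨w, -, hmax⟩ := hb.isCompact_closure.exists_isMaxOn hne.closure
    (Metric.continuous_infDist_pt Ωᶜ).continuousOn
  have hle : ∀ (v : ℂ) (r : ℝ), 0 < r → Metric.ball v r ⊆ Ω → r ≤ Metric.infDist w Ωᶜ := by
    intro v r hr hball
    have h1 : r ≤ Metric.infDist v Ωᶜ := (Metric.le_infDist hcne).2 fun y hy => by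
      by_contra! hlt
      exact hy (hball (Metric.mem_ball'.2 hlt))
    exact h1.trans (hmax (subset_closure (hball (Metric.mem_ball_self hr))))
  obtain ⟨v, hv⟩ := hne
  obtain ⟨ε, hε, hball⟩ := Metric.isOpen_iff.1 ho v hv
  have hpos := hε.trans_le (hle v ε hε hball)
  refine ⟨w, Metric.infDist w Ωᶜ, hpos, Metric.ball_infDist_compl_subset, fun v r h => ?_⟩
  -- Balls of radius `r ≤ 0` are empty, hence contained in `Ω` for every centre.
  rcases le_or_gt r 0 with hr | hr
  · exact hr.trans hpos.le
  · exact hle v r hr h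

/-! ### Odd winding number and the lift. -/

theorem mem_enclosedRegion_sub {K : Set ℂ} {w : ℂ} (hw : w ∈ enclosedRegion K) :
    (0 : ℂ) ∈ enclosedRegion ((fun z => z - w) '' K) := by
  have h : ((fun z => z - w) '' K)ᶜ = (Homeomorph.subRight w) '' Kᶜ :=
    (image_compl_eq (Homeomorph.subRight w).bijective).symm
  refine ⟨?_, ?_⟩
  · rintro ⟨z, hz, hzw⟩
    exact hw.1 (sub_eq_zero.1 hzw ▸ hz)
  · have h1 := (Homeomorph.subRight w).image_connectedComponentIn (s := Kᶜ) (x := w) hw.1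
    rw [h, show (0 : ℂ) = Homeomorph.subRight w w by simp, ← h1]
    exact (LipschitzWith.of_dist_le_mul (K := 1) (f := Homeomorph.subRight w)
      (by simp)).isBounded_image hw.2

/-- A continuous `2π`-periodic function on the line descends to the circle. -/
theorem exists_continuous_comp_circleExp {φ : ℝ → ℂ} (hφ : Continuous φ)
    (hp : Function.Periodic φ (2 * Real.pi)) :
    ∃ g : Circle → ℂ, Continuous g ∧ ∀ t, g (Circle.exp t) = φ t := by
  have h : ∀ t, φ (arg (Circle.exp t : ℂ)) = φ t := fun t => by
    obtain ⟨n, hn⟩ := Circle.exp_eq_exp.1 (Circle.exp_arg (Circle.exp t))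
    rw [hn]
    exact hp.int_mul n t
  have hq : IsQuotientMap Circle.exp := isLocalHomeomorph_circleExp.isOpenMap.isQuotientMap
    Circle.exp.continuous fun z => ⟨_, Circle.exp_arg z⟩
  exact ⟨fun z => φ (arg (z : ℂ)), hq.continuous_iff.2 (hφ.congr fun t => (h t).symm), h⟩

theorem isConnected_range_circle {k : Circle → ℂ} (hk : Continuous k) : IsConnected (range k) := by
  have h : range k = range fun t : ℝ => k (Circle.exp t) :=
    Subset.antisymm (by rintro _ ⟨z, rfl⟩; exact ⟨arg (z : ℂ), by simp only [Circle.exp_arg]⟩)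
      (by rintro _ ⟨t, rfl⟩; exact ⟨_, rfl⟩)
  rw [h]
  exact isConnected_range (hk.comp Circle.exp.continuous)

/-- A Jordan curve enclosing `0` has odd winding number about `0`. -/
theorem exists_odd_winding {f : Circle → ℂ} (hf : Continuous f) (hinj : Function.Injective f)
    (h0 : (0 : ℂ) ∈ enclosedRegion (range f)) {φ : ℝ → ℂ} (hφ : Continuous φ)
    (he : ∀ t, exp (φ t) = f (Circle.exp t)) :
    ∃ n : ℤ, Odd n ∧ ∀ t, φ (t + 2 * Real.pi) = φ t + n * (2 * Real.pi * I) := by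
  have hexp : ∀ t ∈ univ, exp (φ (t + 2 * Real.pi)) = exp (φ t) := fun t _ => by
    rw [he, he, Circle.exp_add_two_pi]
  obtain ⟨n, hn⟩ := exp_eq_exp_iff_exists_int.1 (hexp 0 trivial)
  have hper : ∀ t, φ (t + 2 * Real.pi) = φ t + n * (2 * Real.pi * I) := fun t => by
    have := sub_eq_sub_of_exp_eq_exp isPreconnected_univ
      (φ := fun t => φ (t + 2 * Real.pi)) (by fun_prop) hφ.continuousOn hexp
      (mem_univ t) (mem_univ 0)
    linear_combination this + hn
  refine ⟨n, ?_, hper⟩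
  rw [← Int.not_even_iff_odd]
  rintro ⟨m, rfl⟩
  -- An even winding number gives a continuous square root `k` of `f`. By injectivity of `f` its
  -- range misses its own negative, so it does not enclose `0`, and twice a logarithm on it is one
  -- for `f`.
  obtain ⟨k, hk, hke⟩ := exists_continuous_comp_circleExp
    (φ := fun t => exp (φ t / 2)) (by fun_prop) fun t => by
      simp only [hper]
      rw [exp_eq_exp_iff_exists_int]
      exact ⟨m, by push_cast; ring⟩
  have hsq : ∀ z, k z ^ 2 = f z := fun z => by
    rw [← Circle.exp_arg z, hke, ← exp_nat_mul, ← he]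
    congr 1
    push_cast
    ring
  have hf0 : ∀ z, f z ≠ 0 := fun z hz => h0.1 ⟨z, hz⟩
  have hk0 : ∀ z, k z ≠ 0 := fun z hz => hf0 z (by rw [← hsq, hz]; simp)
  have hnotmem : (0 : ℂ) ∉ enclosedRegion (range k) := by
    refine zero_notMem_enclosedRegion (isCompact_range hk) (isConnected_range_circle hk) ?_
    rintro _ ⟨a, rfl⟩ ⟨b, hb⟩
    obtain rfl : b = a := hinj (by rw [← hsq, ← hsq, hb, neg_sq])
    exact hk0 b (self_eq_neg.1 hb)
  obtain ⟨ψ, hψ, hψe⟩ := hasLogOn_of_notMem (isCompact_range hk)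
    (by rintro ⟨z, hz⟩; exact hk0 z hz) hnotmem
  refine not_exists_log_of_zero_mem_enclosedRegion (hf.isClosedEmbedding hinj) h0
    (ψ := fun z => 2 * ψ (k z))
    (continuous_const.mul (hψ.comp_continuous hk fun z => ⟨z, rfl⟩)) fun z => ?_
  rw [two_mul, exp_add, hψe _ ⟨z, rfl⟩, sub_zero, ← sq, hsq]

/-- A Jordan curve enclosing `0` lifts through the winding map to an odd curve. -/
theorem exists_odd_lift_windingMap {f : Circle → ℂ} (hf : Continuous f)
    (hinj : Function.Injective f) (h0 : (0 : ℂ) ∈ enclosedRegion (range f)) :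
    ∃ g : Circle → ℂ, Continuous g ∧ (∀ z, f (z ^ 2) = windingMap (g z)) ∧
      ∀ z, g (-z) = -g z := by
  obtain ⟨φ, hφ, he⟩ := exists_continuous_log (f := fun t : ℝ => f (Circle.exp t))
    (hf.comp Circle.exp.continuous) fun t ht => h0.1 ⟨_, ht⟩
  obtain ⟨n, hodd, hper⟩ := exists_odd_winding hf hinj h0 hφ he
  set G : ℝ → ℂ := fun t => (Real.exp (φ (2 * t)).re : ℂ) *
    exp (((φ (2 * t)).im / 2 : ℝ) * I) with hG
  have hGc : Continuous G := by fun_prop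
  -- Advancing `t` by `π` changes the halved argument by an odd multiple of `π`.
  have hanti : Function.Antiperiodic G Real.pi := fun t => by
    obtain ⟨m, rfl⟩ := hodd
    have hre : (φ (2 * (t + Real.pi))).re = (φ (2 * t)).re := by
      rw [mul_add, hper]; simp
    have him : (φ (2 * (t + Real.pi))).im =
        (φ (2 * t)).im + (2 * m + 1 : ℤ) * (2 * Real.pi) := by
      rw [mul_add, hper]; simp
    simp only [hG, hre, him]
    rw [show (((φ (2 * t)).im + (2 * m + 1 : ℤ) * (2 * Real.pi)) / 2 : ℝ) * I =
      ((φ (2 * t)).im / 2 : ℝ) * I + (m * (2 * Real.pi * I) + Real.pi * I) by push_cast; ring,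
      exp_add, exp_add, exp_int_mul_two_pi_mul_I, exp_pi_mul_I]
    ring
  obtain ⟨g, hg, hgG⟩ := exists_continuous_comp_circleExp hGc hanti.periodic_two_mul
  refine ⟨g, hg, fun z => ?_, fun z => ?_⟩
  · rw [← Circle.exp_arg z, hgG, hG, windingMap_polar _ _ (Real.exp_pos _).le, ofReal_exp,
      ← exp_add, ← Circle.exp_natCast_mul]
    push_cast
    rw [← he, mul_div_cancel₀ _ (two_ne_zero' ℂ), re_add_im]
  · rw [← Circle.exp_arg z, show -Circle.exp (arg (z : ℂ)) = Circle.exp (arg (z : ℂ) + Real.pi) by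
      
      ext
      rw [Circle.exp_add, Circle.coe_mul, Circle.coe_exp Real.pi, exp_pi_mul_I, mul_neg_one]
      rfl, hgG, hgG]
    exact hanti _

/-! ### Metric estimates for the winding map and the circle. -/

theorem norm_windingMap (z : ℂ) : ‖windingMap z‖ = ‖z‖ := by
  rcases eq_or_ne z 0 with rfl | hz
  · simp [windingMap]
  · rw [windingMap, norm_div, norm_pow, norm_real, norm_norm]
    field_simp

theorem norm_polar_sub_polar_sq (r s α β : ℝ) :
    ‖r * exp (α * I) - s * exp (β * I)‖ ^ 2 =
      r ^ 2 + s ^ 2 - 2 * (r * s) * Real.cos (α - β) := by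
  rw [← normSq_eq_norm_sq, normSq_apply]
  simp only [sub_re, sub_im, re_ofReal_mul, im_ofReal_mul, exp_ofReal_mul_I_re,
    exp_ofReal_mul_I_im, Real.cos_sub]
  linear_combination r ^ 2 * Real.sin_sq_add_cos_sq α + s ^ 2 * Real.sin_sq_add_cos_sq β

/-- Law of cosines: `c` is the cosine of the angle between `u` and `v`, and doubling the angle turns
it into `2 * c ^ 2 - 1`. -/
theorem exists_norm_sub_sq_windingMap (u v : ℂ) : ∃ c : ℝ, |c| ≤ 1 ∧
    ‖u - v‖ ^ 2 = ‖u‖ ^ 2 + ‖v‖ ^ 2 - 2 * (‖u‖ * ‖v‖) * c ∧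
    ‖windingMap u - windingMap v‖ ^ 2 =
      ‖u‖ ^ 2 + ‖v‖ ^ 2 - 2 * (‖u‖ * ‖v‖) * (2 * c ^ 2 - 1) := by
  refine ⟨Real.cos (arg u - arg v), Real.abs_cos_le_one _, ?_, ?_⟩
  · rw [← norm_polar_sub_polar_sq, norm_mul_exp_arg_mul_I, norm_mul_exp_arg_mul_I]
  · rw [← Real.cos_two_mul, mul_sub, ← norm_polar_sub_polar_sq]
    push_cast
    rw [← windingMap_polar _ _ (norm_nonneg u), ← windingMap_polar _ _ (norm_nonneg v),
      norm_mul_exp_arg_mul_I, norm_mul_exp_arg_mul_I]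

theorem norm_windingMap_sub_le (u v : ℂ) :
    ‖windingMap u - windingMap v‖ ≤ 2 * ‖u - v‖ := by
  obtain ⟨c, -, h1, h2⟩ := exists_norm_sub_sq_windingMap u v
  refine abs_le_of_sq_le_sq' ?_ (by positivity) |>.2
  rw [mul_pow, h1, h2]
  -- The difference of the two sides is `3 * (‖u‖ - ‖v‖) ^ 2 + 4 * ‖u‖ * ‖v‖ * (1 - c) ^ 2`.
  have := mul_nonneg (mul_nonneg (norm_nonneg u) (norm_nonneg v)) (sq_nonneg (1 - c))
  nlinarith [sq_nonneg (‖u‖ - ‖v‖)]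

/-- The winding map does not decrease the distance of two points at angle at most `π / 2`. -/
theorem norm_sub_le_norm_windingMap_sub {u v : ℂ} (h : ‖u - v‖ ≤ ‖u‖) :
    ‖u - v‖ ≤ ‖windingMap u - windingMap v‖ := by
  obtain ⟨c, hc, h1, h2⟩ := exists_norm_sub_sq_windingMap u v
  refine abs_le_of_sq_le_sq' ?_ (norm_nonneg _) |>.2
  rcases (norm_nonneg v).eq_or_lt with hv | hv
  · rw [h1, h2, ← hv]
    simp
  have hu : 0 < ‖u‖ := by
    rcases (norm_nonneg u).eq_or_lt with hu | hu
    · have := (norm_sub_norm_le v u).trans_eq (norm_sub_rev v u)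
      linarith
    · exact hu
  have hc0 : 0 ≤ c := by
    have h3 := pow_le_pow_left₀ (norm_nonneg _) h 2
    rw [h1] at h3
    by_contra! hneg
    nlinarith [mul_pos hu hv, mul_pos (mul_pos hu hv) (neg_pos.2 hneg)]
  have hc1 := (abs_le.1 hc).2
  rw [h1, h2]
  have : 0 ≤ (‖u‖ * ‖v‖) * ((1 - c) * (1 + 2 * c)) := by
    have := sub_nonneg.2 hc1
    positivity
  nlinarith

/-- A function on the line which is `C`-Lipschitz at small scale is `C`-Lipschitz. -/
theorem norm_sub_le_of_small_scale {E : Type*} [SeminormedAddCommGroup E] {G : ℝ → E} {C δ : ℝ}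
    (hδ : 0 < δ) (h : ∀ s t, |s - t| ≤ δ → ‖G s - G t‖ ≤ C * |s - t|) (s t : ℝ) :
    ‖G s - G t‖ ≤ C * |s - t| := by
  -- Passing through the midpoint doubles the admissible scale.
  have key : ∀ n : ℕ, ∀ s t, |s - t| ≤ 2 ^ n * δ → ‖G s - G t‖ ≤ C * |s - t| := by
    intro n
    induction n with
    | zero => simpa using h
    | succ n ih =>
      intro s t hst
      have h1 : |s - (s + t) / 2| = |s - t| / 2 := by
        rw [show s - (s + t) / 2 = (s - t) / 2 by ring, abs_div, abs_two]
      have h2 : |(s + t) / 2 - t| = |s - t| / 2 := by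
        rw [show (s + t) / 2 - t = (s - t) / 2 by ring, abs_div, abs_two]
      rw [pow_succ] at hst
      have h3 := ih s ((s + t) / 2) (by rw [h1]; linarith)
      have h4 := ih ((s + t) / 2) t (by rw [h2]; linarith)
      rw [h1] at h3
      rw [h2] at h4
      linarith [norm_sub_le_norm_sub_add_norm_sub (G s) (G ((s + t) / 2)) (G t)]
  obtain ⟨n, hn⟩ := pow_unbounded_of_one_lt (|s - t| / δ) one_lt_two
  exact key n s t ((div_lt_iff₀ hδ).1 hn).le

theorem norm_circleExp_sub (s t : ℝ) :
    ‖(Circle.exp s : ℂ) - Circle.exp t‖ = 2 * |Real.sin ((s - t) / 2)| := by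
  have h := norm_exp_I_mul_ofReal_sub_one (s - t)
  rw [Real.norm_eq_abs, abs_mul, abs_two] at h
  rw [← h, ← mul_one ‖exp (I * ↑(s - t)) - 1‖, ← Circle.norm_coe (Circle.exp t), ← norm_mul,
    sub_mul, one_mul, Circle.coe_exp, Circle.coe_exp, ← exp_add]
  congr 3
  push_cast
  ring

theorem norm_circleExp_sub_le (s t : ℝ) : ‖(Circle.exp s : ℂ) - Circle.exp t‖ ≤ |s - t| := by
  rw [norm_circleExp_sub]
  have := Real.abs_sin_le_abs (x := (s - t) / 2)
  rw [abs_div, abs_two] at this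
  linarith

/-- Points of the circle have arguments whose difference is at most `π / 2` times their
distance. -/
theorem exists_circleExp_eq (a b : Circle) : ∃ s t : ℝ, Circle.exp s = a ∧ Circle.exp t = b ∧
    |s - t| ≤ Real.pi / 2 * ‖(a : ℂ) - b‖ := by
  refine ⟨arg (b : ℂ) + arg ((a / b : Circle) : ℂ), arg (b : ℂ), ?_, Circle.exp_arg b, ?_⟩
  · rw [Circle.exp_add, Circle.exp_arg, Circle.exp_arg, mul_div_cancel]
  · set τ := arg ((a / b : Circle) : ℂ)
    have ha : Circle.exp (arg (b : ℂ) + τ) = a := by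
      rw [Circle.exp_add, Circle.exp_arg, Circle.exp_arg, mul_div_cancel]
    have hab := norm_circleExp_sub (arg (b : ℂ) + τ) (arg (b : ℂ))
    rw [ha, Circle.exp_arg, add_sub_cancel_left] at hab
    rw [hab, add_sub_cancel_left]
    have hpi := Real.pi_pos
    have hτ : |τ| ≤ Real.pi := abs_arg_le_pi _
    have h1 : 2 / Real.pi * (|τ| / 2) ≤ Real.sin (|τ| / 2) :=
      Real.mul_le_sin (by positivity) (by linarith)
    have h2 : Real.sin (|τ| / 2) ≤ |Real.sin (τ / 2)| := by
      rcases abs_choice τ with h | h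
      · rw [h]; exact le_abs_self _
      · rw [h, neg_div, Real.sin_neg]; exact neg_le_abs _
    have h3 := h1.trans h2
    rw [div_mul_eq_mul_div, div_le_iff₀ hpi] at h3
    linarith

/-! ### The two bounds for the lift. -/

section Bounds
variable {L l : ℝ} {f g : Circle → ℂ}

/-- Uniform continuity at scale `R ≤ ‖g z‖` keeps nearby values at angle at most `π / 2`. Squaring
on the circle gives the factor `2`, arc against chord the factor `π / 2`. -/
theorem IsBiLipschitz.norm_lift_sub_le (hf : IsBiLipschitz L l f) {w : ℂ} (hg : Continuous g)
    (hfg : ∀ z, f (z ^ 2) - w = windingMap (g z)) {R : ℝ} (hR : 0 < R)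
    (hRg : ∀ z, R ≤ ‖g z‖) (a b : Circle) : ‖g a - g b‖ ≤ Real.pi * L * ‖(a : ℂ) - b‖ := by
  have huc : UniformContinuous g := CompactSpace.uniformContinuous_of_continuous hg
  obtain ⟨δ, hδ, hu⟩ := Metric.uniformContinuous_iff.1 huc R hR
  have hsmall : ∀ s t : ℝ, |s - t| ≤ δ / 2 →
      ‖g (Circle.exp s) - g (Circle.exp t)‖ ≤ 2 * L * |s - t| := by
    intro s t hst
    have hd : dist (Circle.exp s) (Circle.exp t) < δ := by
      have h1 : dist (Circle.exp s) (Circle.exp t) = ‖(Circle.exp s : ℂ) - Circle.exp t‖ :=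
        dist_eq_norm (Circle.exp s : ℂ) (Circle.exp t)
      rw [h1]
      linarith [norm_circleExp_sub_le s t]
    have h2 := hu hd
    rw [dist_eq_norm] at h2
    refine (norm_sub_le_norm_windingMap_sub (h2.le.trans (hRg _))).trans ?_
    rw [← hfg, ← hfg, sub_sub_sub_cancel_right, ← Circle.exp_natCast_mul,
      ← Circle.exp_natCast_mul]
    refine (hf.2.2 _ _).2.trans ?_
    have h3 := norm_circleExp_sub_le ((2 : ℕ) * s) ((2 : ℕ) * t)
    rw [← mul_sub, abs_mul, Nat.abs_cast] at h3
    refine (mul_le_mul_of_nonneg_left h3 hf.1.le).trans_eq ?_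
    push_cast
    ring
  obtain ⟨s, t, rfl, rfl, hst⟩ := exists_circleExp_eq a b
  have h4 := norm_sub_le_of_small_scale (G := fun t => g (Circle.exp t)) (half_pos hδ) hsmall s t
  have := mul_le_mul_of_nonneg_left hst (mul_pos two_pos hf.1).le
  linarith

theorem IsBiLipschitz.le_norm_lift_sub (hf : IsBiLipschitz L l f) {w : ℂ} (hg : Continuous g)
    (hfg : ∀ z, f (z ^ 2) - w = windingMap (g z)) (hneg : ∀ z, g (-z) = -g z)
    (hRg : ∀ z, l / √2 ≤ ‖g z‖) (a b : Circle) :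
    l ^ 2 / (2 * Real.pi * L) * ‖(a : ℂ) - b‖ ≤ ‖g a - g b‖ := by
  have hL := hf.1
  have hl := hf.2.1
  have hpi := Real.pi_gt_three
  have hR : 0 < l / √2 := by positivity
  -- The threshold makes the 2-Lipschitz estimate give exactly the claimed constant; below it `‖g a
  -- + g b‖ < l`.
  rcases le_or_gt l (Real.pi * L * ‖(a : ℂ) + b‖) with hs | hs
  · have h1 := (hf.2.2 (a ^ 2) (b ^ 2)).1
    have h2 := norm_windingMap_sub_le (g a) (g b)
    rw [← hfg, ← hfg, sub_sub_sub_cancel_right] at h2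
    rw [Circle.coe_pow, Circle.coe_pow, sq_sub_sq, norm_mul] at h1
    have h3 : l / (2 * Real.pi * L) ≤ ‖(a : ℂ) + b‖ / 2 := by
      rw [div_le_iff₀ (by positivity)]
      linarith
    calc l ^ 2 / (2 * Real.pi * L) * ‖(a : ℂ) - b‖
        = l / (2 * Real.pi * L) * (l * ‖(a : ℂ) - b‖) := by ring
      _ ≤ ‖(a : ℂ) + b‖ / 2 * (l * ‖(a : ℂ) - b‖) :=
          mul_le_mul_of_nonneg_right h3 (by positivity)
      _ ≤ ‖g a - g b‖ := by linarith
  · have h1 := hf.norm_lift_sub_le hg hfg hR hRg a (-b)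
    rw [hneg, sub_neg_eq_add, show (a : ℂ) - ((-b : Circle) : ℂ) = a + b by
      rw [show ((-b : Circle) : ℂ) = -(b : ℂ) from rfl, sub_neg_eq_add]] at h1
    have h2 : 2 * ‖g b‖ ≤ ‖g a + g b‖ + ‖g a - g b‖ := by
      have := norm_sub_le (g a + g b) (g a - g b)
      rwa [show g a + g b - (g a - g b) = 2 * g b by ring, norm_mul, RCLike.norm_two] at this
    -- This leaves `‖g a - g b‖ ≥ 0.4 * l`, whereas the target is at most `l / 3` because `l ≤ L`
    -- and `π > 3`.
    have h3 : 1.4 * l ≤ 2 * (l / √2) := by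
      rw [← mul_div_assoc, le_div_iff₀ (by positivity)]
      have : √2 ≤ 1.42 := Real.sqrt_le_iff.2 (by norm_num)
      nlinarith
    have h4 : ‖(a : ℂ) - b‖ ≤ 2 := by
      refine (norm_sub_le _ _).trans ?_
      rw [Circle.norm_coe, Circle.norm_coe]
      norm_num
    have h5 : l ^ 2 / (2 * Real.pi * L) ≤ l / 6 := by
      rw [div_le_iff₀ (by positivity)]
      nlinarith [mul_le_mul_of_nonneg_left hf.le hl.le, mul_pos hl hL]
    have h6 : l ^ 2 / (2 * Real.pi * L) * ‖(a : ℂ) - b‖ ≤ l / 6 * 2 :=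
      mul_le_mul h5 h4 (norm_nonneg _) (by positivity)
    linarith [hRg b]

end Bounds

/-! ### Uniqueness and conclusion. -/

theorem IsWindingSymmetrization.eq_or_eq_neg {f g h : Circle → ℂ}
    (hg : IsWindingSymmetrization f g) (hh : IsWindingSymmetrization f h) : h = g ∨ h = -g := by
  -- The winding map determines the modulus, hence the square; connectedness of the circle then
  -- makes the sign constant.
  have hW : ∀ z, h z ^ 2 = g z ^ 2 := fun z => by
    have heq : windingMap (h z) = windingMap (g z) := by rw [← hh.comp_eq, hg.comp_eq]
    have hn : ‖h z‖ = ‖g z‖ := by rw [← norm_windingMap, heq, norm_windingMap]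
    have hg0 : (‖g z‖ : ℂ) ≠ 0 := by simpa using hg.right_ne_zero z
    rw [windingMap, windingMap, hn] at heq
    exact (div_left_inj' hg0).1 heq
  have hconn : IsPreconnected (univ : Set Circle) := by
    rw [← (show Function.Surjective Circle.exp from fun z => ⟨_, Circle.exp_arg z⟩).range_eq]
    exact isPreconnected_range Circle.exp.continuous
  refine (hconn.eq_or_eq_neg_of_sq_eq hh.isEmbedding_right.continuous.continuousOn
    hg.isEmbedding_right.continuous.continuousOn (fun z _ => hW z)
    fun z => hg.right_ne_zero _).imp ?_ ?_ <;>
  exact fun H => funext fun z => H (mem_univ z)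

theorem corollary8p5 (L l : ℝ) (f : Circle → ℂ) (hf : IsBiLipschitz L l f) :
    (∃ w₀ : ℂ, IsIncenter (enclosedRegion (Set.range f)) w₀) ∧
    ∀ w₀ : ℂ, IsIncenter (enclosedRegion (Set.range f)) w₀ →
      ∃ g : Circle → ℂ,
        IsWindingSymmetrization (fun z => f z - w₀) g ∧
        (∀ h : Circle → ℂ, IsWindingSymmetrization (fun z => f z - w₀) h → h = g ∨ h = -g) ∧
        IsBiLipschitz (Real.pi * L) (l ^ 2 / (2 * Real.pi * L)) g := by
  have hK : IsCompact (range f) := isCompact_range hf.continuous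
  have hL := hf.1
  have hl := hf.2.1
  have hpi := Real.pi_pos
  refine ⟨exists_isIncenter (isOpen_enclosedRegion hK.isClosed)
    (isBounded_enclosedRegion hK.isBounded)
    (enclosedRegion_range_nonempty hf.continuous hf.injective), fun w₀ hw₀ => ?_⟩
  obtain ⟨R, hR, hball, hmax⟩ := hw₀
  obtain ⟨v, hv⟩ := hf.exists_ball_subset
  have hlR : l / √2 ≤ R := hmax _ _ hv
  have hRf : ∀ z, R ≤ ‖f z - w₀‖ := fun z => by
    by_contra! hlt
    exact (hball (by rwa [Metric.mem_ball, dist_eq_norm])).1 ⟨z, rfl⟩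
  have hemb : IsEmbedding fun z => f z - w₀ :=
    (Homeomorph.subRight w₀).isEmbedding.comp hf.isEmbedding
  have h0 : (0 : ℂ) ∈ enclosedRegion (range fun z => f z - w₀) := by
    have := mem_enclosedRegion_sub (hball (Metric.mem_ball_self hR))
    rwa [← range_comp] at this
  obtain ⟨g, hg, hfg, hneg⟩ := exists_odd_lift_windingMap hemb.continuous hemb.injective h0
  have hRg : ∀ z, R ≤ ‖g z‖ := fun z => by
    rw [← norm_windingMap, ← hfg]
    exact hRf _
  have hbi : IsBiLipschitz (Real.pi * L) (l ^ 2 / (2 * Real.pi * L)) g :=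
    ⟨by positivity, by positivity, fun a b =>
      ⟨hf.le_norm_lift_sub hg hfg hneg (fun z => hlR.trans (hRg z)) a b,
        hf.norm_lift_sub_le hg hfg hR hRg a b⟩⟩
  have hsymm : IsWindingSymmetrization (fun z => f z - w₀) g :=
    ⟨hemb, h0, hbi.isEmbedding, fun z => norm_pos_iff.1 (hR.trans_le (hRg z)), hfg⟩
  exact ⟨g, hsymm, fun h hh => hsymm.eq_or_eq_neg hh, hbi⟩
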